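/- Let $(R,\mathfrak m)$ be a Noetherian local domain of Krull dimension one with field of fractions $Q(R)$, and assume that $R$ is analytically irreducible, that is, the integral closure $\overline R$ of $R$ in $Q(R)$ is a discrete valuation ring and a finitely generated $R$-module. Let $\mathfrak n$ be the maximal ideal of $\overline R$ and $v$ the normalized discrete valuation of $\overline R$. Assume that the canonical map $R/\mathfrak m\to\overline R/\mathfrak n$ is an isomorphism, that $R/\mathfrak m$ is infinite, and that $R$ is Gorenstein (i.e. $R$ has finite injective dimension as a module over itself). Let $H=v(R)=\{v(r) : r\in R\setminus\{0\}\}$ be the value semigroup of $R$. For a finitely generated $R$-module $M$ put $\operatorname{tr}(M)=\sum_{\varphi\in\operatorname{Hom}_R(M,R)}\varphi(M)$; an ideal $I$ of $R$ is called a trace ideal if $I=\operatorname{tr}(M)$ for some finitely generated $R$-module $M$. Write $\langle A\rangle$ for the additive submonoid of $\mathbb Z_{\ge 0}$ generated by $A$. Then the following conditions are equivalent: (i) $R$ has only finitely many trace ideals; (ii) $H=\langle 1\rangle$, or $H=\langle 2,a\rangle$ for some odd number $a>2$, or $H=\langle 3,4\rangle$, or $H=\langle 3,5\rangle$; (iii)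 every trace ideal $I$ of $R$ is integrally closed, i.e. every $x\in R$ satisfying an equation $x^n+a_1x^{n-1}+\cdots+a_n=0$ with $n\ge 1$ and $a_i\in I^i$ for $1\le i\le n$ belongs to $I$. -/

import Mathlib

namespace TraceIdeals

universe u v

/-- The trace of an `R`-module `M`: the sum of the ideals `φ(M)` over all `R`-linear `φ : M → R`. -/
def moduleTrace (R : Type u) [CommRing R] (M : Type v) [AddCommGroup M] [Module R M] : Ideal R :=
  ⨆ φ : M →ₗ[R] R, LinearMap.range φ

/-- `I` is a trace ideal if it is the trace of a finitely generated `R`-module. (Every finitely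
generated `R`-module is isomorphic to one in the universe of `R`.) -/
def IsTraceIdeal {R : Type u} [CommRing R] (I : Ideal R) : Prop :=
  ∃ (M : Type u) (_ : AddCommGroup M) (_ : Module R M),
    Module.Finite R M ∧ I = moduleTrace R M

/-- `x` is integral over the ideal `I`: it satisfies an equation
`x ^ n + a₁ x ^ (n - 1) + ⋯ + aₙ = 0` with `n ≥ 1` and `aᵢ ∈ I ^ i`. -/
def IsIntegralOverIdeal {R : Type u} [CommRing R] (I : Ideal R) (x : R) : Prop :=
  ∃ (n : ℕ) (a : ℕ → R), 0 < n ∧ (∀ i ∈ Finset.Icc 1 n, a i ∈ I ^ i) ∧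
    x ^ n + ∑ i ∈ Finset.Icc 1 n, a i * x ^ (n - i) = 0

/-- `I` is integrally closed (as an ideal): it contains every element of `R` integral over it. -/
def IsIntegrallyClosedIdeal {R : Type u} [CommRing R] (I : Ideal R) : Prop :=
  ∀ x : R, IsIntegralOverIdeal I x → x ∈ I

/-- A local ring is Gorenstein if it is Noetherian and has finite injective dimension as a module
over itself. -/
def IsGorensteinLocalRing (R : Type u) [CommRing R] [IsLocalRing R] : Prop :=
  IsNoetherianRing R ∧
    ∃ n : ℕ, CategoryTheory.HasInjectiveDimensionLE (ModuleCat.of R R) n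

/-- The value semigroup `{v(r) | r ∈ R, r ≠ 0}` of a domain `R` with respect to the normalized
valuation `v` of a discrete valuation ring `S ⊇ R`. -/
noncomputable def valueSemigroup (R : Type u) [CommRing R] [IsDomain R]
    (S : Type v) [CommRing S] [IsDomain S] [IsDiscreteValuationRing S] [Algebra R S] :
    AddSubmonoid ℕ where
  carrier := {n | ∃ r : R, r ≠ 0 ∧ IsDiscreteValuationRing.addVal S (algebraMap R S r) = n}
  zero_mem' := ⟨1, one_ne_zero, by simp⟩
  add_mem' := by
    rintro m n ⟨r, hr, hm⟩ ⟨s, hs, hn⟩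
    exact ⟨r * s, mul_ne_zero hr hs, by
      rw [map_mul, IsDiscreteValuationRing.addVal_mul, hm, hn, Nat.cast_add]⟩

end TraceIdeals

/-!
Write `B` for the integral closure of `R`, `𝔫` for its maximal ideal and `v` for its valuation.
Since the residue fields agree, nested `R`-submodules of `B` that contain a power of `𝔫` and have
the same values coincide. A nonzero trace ideal contains the conductor `𝔫 ^ c`, and an ideal of `R`
is integrally closed exactly when it is of the form `R ∩ J` for an ideal `J` of `B`; hence (iii)
implies (i).

If `R` is Gorenstein, `Ext ^ 1 (I, R)` vanishes for every ideal `I`, while `Ext ^ 1 (M, R)` is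
nonzero for every nonzero module `M` of finite length. Consequently fractional ideals `S ⊆ T` with
the same dual `R : S = R : T` coincide. Comparing `R + 𝔫 ^ g` with `R + 𝔫 ^ (g + 1)` yields the
symmetry of `H`. The dual `R : S` of an overring `S` of `R` is a trace ideal, so distinct overrings
give distinct trace ideals; if `p ≥ 2` and `p + 1` are gaps of `H`, the overrings
`R + R u + 𝔫 ^ (p + 2)` with `v u = p` form a family indexed by the infinite residue field. Hence
(i) forces `H` to be symmetric without consecutive gaps above `1`, which leaves the semigroups of
(ii).

For these semigroups, at most one element of `H ∩ [m, c)` lies outside `m + H` for each `m ∈ H`. So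
a trace ideal `I` with least value `m` attained at `x` either is contained in `x R + 𝔫 ^ c` or
has all values of `R ∩ 𝔫 ^ m`. In both cases `I = R ∩ 𝔫 ^ m`, in the first one because `z / x` maps
`I` into `R` for every `z ∈ R ∩ 𝔫 ^ m`.
-/

namespace TraceIdeals

open IsLocalRing Function
open IsDiscreteValuationRing hiding maximalIdeal

universe u v

section Ext

open CategoryTheory CategoryTheory.Abelian

variable {R : Type u} [CommRing R]

theorem shortExact_of_exact {L M N : Type u} [AddCommGroup L] [Module R L] [AddCommGroup M]
    [Module R M] [AddCommGroup N] [Module R N] {f : L →ₗ[R] M} {g : M →ₗ[R] N}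
    (hf : Injective f) (hg : Surjective g) (hfg : Exact f g) :
    (ModuleCat.shortComplexOfCompEqZero f g hfg.linearMap_comp_eq_zero).ShortExact :=
  ModuleCat.shortComplex_shortExact _ hfg hf hg

variable (R) in
/-- `Ext ^ n (M, R) = 0`. Stating this for modules rather than for objects of `ModuleCat R` keeps
the category theory confined to the long exact sequences. -/
def ExtVanishes (M : Type u) [AddCommGroup M] [Module R M] (n : ℕ) : Prop :=
  Subsingleton (Ext.{u} (ModuleCat.of R M) (ModuleCat.of R R) n)

namespace ExtVanishes

variable {L M N : Type u} [AddCommGroup L] [Module R L] [AddCommGroup M] [Module R M]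
  [AddCommGroup N] [Module R N]

theorem of_projective (M : Type u) [AddCommGroup M] [Module R M] [Module.Projective R M] (n : ℕ) :
    ExtVanishes R M (n + 1) :=
  have : Projective (ModuleCat.of R M) := inferInstance
  Ext.subsingleton_of_projective _ _ _

theorem of_hasInjectiveDimensionLE {d n : ℕ} [HasInjectiveDimensionLE (ModuleCat.of R R) d]
    (hn : d < n) (M : Type u) [AddCommGroup M] [Module R M] : ExtVanishes R M n :=
  HasInjectiveDimensionLT.subsingleton _ (d + 1) n hn _

section ExactSequence

variable {f : L →ₗ[R] M} {g : M →ₗ[R] N}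

theorem of_ends (hf : Injective f) (hg : Surjective g) (hfg : Exact f g) {n : ℕ}
    (hL : ExtVanishes R L n) (hN : ExtVanishes R N n) : ExtVanishes R M n := by
  refine subsingleton_of_forall_eq 0 fun x => ?_
  obtain ⟨y, rfl⟩ := Ext.contravariant_sequence_exact₂ (shortExact_of_exact hf hg hfg) _ x
    (hL.elim _ _)
  rw [hN.elim y 0, Ext.comp_zero]

theorem of_sub (hf : Injective f) (hg : Surjective g) (hfg : Exact f g) {n : ℕ}
    (hM : ExtVanishes R M n) (hN : ExtVanishes R N (n + 1)) : ExtVanishes R L n := by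
  refine subsingleton_of_forall_eq 0 fun x => ?_
  obtain ⟨y, rfl⟩ := Ext.contravariant_sequence_exact₁ (shortExact_of_exact hf hg hfg) _ x
    (add_comm 1 n) (hN.elim _ _)
  rw [hM.elim y 0, Ext.comp_zero]

theorem of_quotient (hf : Injective f) (hg : Surjective g) (hfg : Exact f g) {n : ℕ}
    (hL : ExtVanishes R L n) (hM : ExtVanishes R M (n + 1)) : ExtVanishes R N (n + 1) := by
  refine subsingleton_of_forall_eq 0 fun x => ?_
  obtain ⟨y, rfl⟩ := Ext.contravariant_sequence_exact₃ (shortExact_of_exact hf hg hfg) _ x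
    (hM.elim _ _) (add_comm 1 n)
  rw [hL.elim y 0, Ext.comp_zero]

theorem of_forall_extension (hf : Injective f) (hg : Surjective g) (hfg : Exact f g)
    (hM : ExtVanishes R M 1) (h : ∀ φ : L →ₗ[R] R, ∃ ψ : M →ₗ[R] R, ψ ∘ₗ f = φ) :
    ExtVanishes R N 1 := by
  have hS := shortExact_of_exact hf hg hfg
  refine subsingleton_of_forall_eq 0 fun x => ?_
  obtain ⟨y, rfl⟩ := Ext.contravariant_sequence_exact₃ hS _ x (hM.elim _ _) (add_zero 1)
  obtain ⟨φ, rfl⟩ := Ext.homEquiv₀.symm.surjective y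
  obtain ⟨ψ, hψ⟩ := h φ.hom
  have hφ : φ = ModuleCat.ofHom f ≫ ModuleCat.ofHom ψ := by
    rw [← ModuleCat.ofHom_comp, hψ, ModuleCat.ofHom_hom]
  rw [hφ, Ext.homEquiv₀_symm_apply, ← Ext.mk₀_comp_mk₀]
  exact hS.extClass_comp_assoc _

theorem exists_lift {f : R →ₗ[R] M} {g : M →ₗ[R] N} (hf : Injective f) (hg : Surjective g)
    (hfg : Exact f g) (hL : ExtVanishes R L 1) (φ : L →ₗ[R] N) : ∃ ψ : L →ₗ[R] M, g ∘ₗ ψ = φ := by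
  obtain ⟨y, hy⟩ := Ext.covariant_sequence_exact₃ _ (shortExact_of_exact hf hg hfg)
    (Ext.mk₀ (ModuleCat.ofHom φ)) (zero_add 1) (hL.elim _ _)
  obtain ⟨ψ, rfl⟩ := Ext.homEquiv₀.symm.surjective y
  have hψ : ψ ≫ ModuleCat.ofHom g = ModuleCat.ofHom φ :=
    Ext.homEquiv₀.symm.injective (by simpa using hy)
  exact ⟨ψ.hom, congrArg ModuleCat.Hom.hom hψ⟩

end ExactSequence

end ExtVanishes

theorem exact_toSpanSingleton_mkQ {R : Type*} [CommRing R] (x : R) :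
    Exact (LinearMap.toSpanSingleton R R x) (Ideal.span {x}).mkQ := by
  rw [LinearMap.exact_iff, Submodule.ker_mkQ, LinearMap.range_toSpanSingleton]

theorem extVanishes_quotient_span_singleton [IsDomain R] {x : R} (hx : x ≠ 0) (n : ℕ) :
    ExtVanishes R (R ⧸ Ideal.span {x}) (n + 2) :=
  .of_quotient (smul_left_injective R hx) (Submodule.mkQ_surjective _)
    (exact_toSpanSingleton_mkQ x) (.of_projective R n) (.of_projective R (n + 1))

end Ext

theorem exists_injective_of_isSimpleModule {R S M : Type*} [CommRing R] [IsLocalRing R]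
    [AddCommGroup S] [Module R S] [AddCommGroup M] [Module R M] (hS : IsSimpleModule R S)
    [IsArtinian R M] [Nontrivial M] : ∃ f : S →ₗ[R] M, Injective f := by
  obtain ⟨T, hT⟩ := IsAtomic.exists_atom (Submodule R M)
  obtain ⟨I, hI, ⟨eT⟩⟩ := isSimpleModule_iff_quot_maximal.1 (isSimpleModule_iff_isAtom.2 hT)
  obtain ⟨J, hJ, ⟨eS⟩⟩ := isSimpleModule_iff_quot_maximal.1 hS
  obtain rfl : I = J := (eq_maximalIdeal hI).trans (eq_maximalIdeal hJ).symm
  exact ⟨T.subtype ∘ₗ (eS.trans eT.symm).toLinearMap,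
    T.injective_subtype.comp (eS.trans eT.symm).injective⟩

section Gorenstein

variable {R : Type u} [CommRing R] [IsDomain R] [IsNoetherianRing R] [Ring.KrullDimLE 1 R]

theorem isFiniteLength_quotient {I : Ideal R} (hI : I ≠ ⊥) : IsFiniteLength R (R ⧸ I) := by
  obtain ⟨x, hxI, hx⟩ := Submodule.exists_mem_ne_zero_of_ne_bot hI
  exact (isFiniteLength_quotient_span_singleton R (mem_nonZeroDivisors_of_ne_zero hx)).of_surjective
    (Submodule.factor_surjective ((Ideal.span_singleton_le_iff_mem I).2 hxI))

variable [IsLocalRing R]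

theorem exists_ne_zero_of_isSimpleModule_injective (hR : ¬ IsField R) : ∃ x : R, x ≠ 0 ∧
    ∀ (S : Type u) [AddCommGroup S] [Module R S], IsSimpleModule R S →
      ∃ f : S →ₗ[R] R ⧸ Ideal.span {x}, Injective f := by
  obtain ⟨x, hxm, hx⟩ := Submodule.exists_mem_ne_zero_of_ne_bot
    (mt isField_iff_maximalIdeal_eq.2 hR)
  refine ⟨x, hx, fun S _ _ hS => ?_⟩
  have : Nontrivial (R ⧸ Ideal.span {x}) :=
    Submodule.Quotient.nontrivial_iff.2 (by rwa [Ne, Ideal.span_singleton_eq_top])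
  have := (isFiniteLength_iff_isNoetherian_isArtinian.1
    (isFiniteLength_quotient (I := Ideal.span {x}) (by simpa))).2
  exact exists_injective_of_isSimpleModule hS

theorem extVanishes_of_isFiniteLength_of_succ (hR : ¬ IsField R) {n : ℕ}
    (h : ∀ (M : Type u) [AddCommGroup M] [Module R M], IsFiniteLength R M →
      ExtVanishes R M (n + 3))
    {M : Type u} [AddCommGroup M] [Module R M] (hM : IsFiniteLength R M) :
    ExtVanishes R M (n + 2) := by
  -- A simple module embeds into `R ⧸ (x)`, which has projective dimension one, and `h` applies to
  -- the cokernel.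
  obtain ⟨x, hx, hemb⟩ := exists_ne_zero_of_isSimpleModule_injective hR
  have extVanishes_simple (S : Type u) [AddCommGroup S] [Module R S] (hS : IsSimpleModule R S) :
      ExtVanishes R S (n + 2) := by
    obtain ⟨f, hf⟩ := hemb S hS
    exact .of_sub hf (Submodule.mkQ_surjective _) (LinearMap.exact_map_mkQ_range f)
      (extVanishes_quotient_span_singleton hx n)
      (h _ ((isFiniteLength_quotient (by simpa)).of_surjective
        (Submodule.mkQ_surjective (LinearMap.range f))))
  induction hM with
  | of_subsingleton => exact .of_projective _ _
  | @of_simple_quotient M _ _ N hN _ ih =>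
    exact .of_ends N.injective_subtype N.mkQ_surjective (LinearMap.exact_subtype_mkQ N) ih
      (extVanishes_simple _ hN)

theorem extVanishes_two_of_isFiniteLength (hR : ¬ IsField R) (hGor : IsGorensteinLocalRing R)
    {M : Type u} [AddCommGroup M] [Module R M] (hM : IsFiniteLength R M) : ExtVanishes R M 2 := by
  obtain ⟨-, d, hd⟩ := hGor
  suffices h : ∀ k n : ℕ, d ≤ k + n → ∀ (M : Type u) [AddCommGroup M] [Module R M],
      IsFiniteLength R M → ExtVanishes R M (n + 2) from h d 0 le_rfl M hM
  intro k
  induction k with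
  | zero => exact fun n hn M _ _ _ => .of_hasInjectiveDimensionLE (d := d) (by lia) M
  | succ k ih =>
    exact fun n hn M _ _ => extVanishes_of_isFiniteLength_of_succ hR (ih (n + 1) (by lia))

theorem extVanishes_one_ideal (hR : ¬ IsField R) (hGor : IsGorensteinLocalRing R) (I : Ideal R) :
    ExtVanishes R I 1 := by
  obtain rfl | hI := eq_or_ne I ⊥
  · exact .of_projective _ _
  · exact .of_sub I.injective_subtype I.mkQ_surjective (LinearMap.exact_subtype_mkQ I)
      (.of_projective R 0) (extVanishes_two_of_isFiniteLength hR hGor (isFiniteLength_quotient hI))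

theorem not_extVanishes_one_of_isSimpleModule (hR : ¬ IsField R) {S : Type u} [AddCommGroup S]
    [Module R S] (hS : IsSimpleModule R S) : ¬ ExtVanishes R S 1 := by
  intro h
  obtain ⟨x, hx, hemb⟩ := exists_ne_zero_of_isSimpleModule_injective hR
  obtain ⟨f, hf⟩ := hemb S hS
  obtain ⟨ψ, rfl⟩ := h.exists_lift (smul_left_injective R hx) (Submodule.mkQ_surjective _)
    (exact_toSpanSingleton_mkQ x) f
  -- `x` kills `S`, because it kills `R ⧸ (x)`; but it acts injectively on `R`, so `ψ = 0`.
  have smul_eq_zero (s : S) : x • s = 0 := hf <| by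
    rw [map_smul, map_zero, LinearMap.comp_apply, ← map_smul, Submodule.mkQ_apply,
      Submodule.Quotient.mk_eq_zero, smul_eq_mul]
    exact Ideal.mul_mem_right _ _ (Ideal.mem_span_singleton_self x)
  have hψ (s : S) : ψ s = 0 := by
    have : x • ψ s = 0 := by rw [← map_smul, smul_eq_zero, map_zero]
    exact (_root_.smul_eq_zero.1 this).resolve_left hx
  have := IsSimpleModule.nontrivial R S
  obtain ⟨s, hs⟩ := exists_ne (0 : S)
  exact hs (hf (by simp only [LinearMap.comp_apply, hψ, map_zero]))

theorem subsingleton_of_extVanishes_one (hR : ¬ IsField R) (hGor : IsGorensteinLocalRing R)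
    {M : Type u} [AddCommGroup M] [Module R M] (hM : IsFiniteLength R M)
    (h : ExtVanishes R M 1) : Subsingleton M := by
  by_contra! hM'
  have := (isFiniteLength_iff_isNoetherian_isArtinian.1 hM).2
  obtain ⟨S, hS⟩ := IsAtomic.exists_atom (Submodule R M)
  exact not_extVanishes_one_of_isSimpleModule hR (isSimpleModule_iff_isAtom.2 hS) <|
    .of_sub S.injective_subtype S.mkQ_surjective (LinearMap.exact_subtype_mkQ S) h <|
      extVanishes_two_of_isFiniteLength hR hGor (hM.of_surjective S.mkQ_surjective)

theorem eq_top_of_forall_exists_extension_ideal (hGor : IsGorensteinLocalRing R) {I : Ideal R}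
    {N : Submodule R I} (hN : N ≠ ⊥)
    (h : ∀ φ : N →ₗ[R] R, ∃ ψ : I →ₗ[R] R, ψ ∘ₗ N.subtype = φ) : N = ⊤ := by
  have hcomap := Submodule.comap_map_eq_of_injective I.injective_subtype N
  set J : Ideal R := N.map I.subtype
  by_contra hN1
  have hJ : J ≠ ⊥ := ((Submodule.map_injective_of_injective I.injective_subtype).ne_iff'
    (Submodule.map_bot _)).2 hN
  have hJ1 : J ≠ ⊤ := fun hJ1 => hN1 (by rw [← hcomap, hJ1, Submodule.comap_top])
  have hR : ¬ IsField R :=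
    Ring.not_isField_iff_exists_ideal_bot_lt_and_lt_top.2 ⟨J, hJ.bot_lt, hJ1.lt_top⟩
  have hker : LinearMap.ker (J.mkQ ∘ₗ I.subtype) = N := by
    rw [LinearMap.ker_comp, Submodule.ker_mkQ, hcomap]
  have hfin : IsFiniteLength R (I ⧸ N) := (isFiniteLength_quotient hJ).of_injective
    (LinearMap.ker_eq_bot.1 (Submodule.ker_liftQ_eq_bot N _ hker.ge hker.le))
  exact hN1 <| Submodule.Quotient.subsingleton_iff.1 <|
    subsingleton_of_extVanishes_one hR hGor hfin <|
      .of_forall_extension N.injective_subtype N.mkQ_surjective (LinearMap.exact_subtype_mkQ N)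
        (extVanishes_one_ideal hR hGor I) h

theorem eq_top_of_forall_exists_extension (hGor : IsGorensteinLocalRing R) {M : Type v}
    [AddCommGroup M] [Module R M] {f : M →ₗ[R] R} (hf : Injective f) {N : Submodule R M}
    (hN : N ≠ ⊥) (h : ∀ φ : N →ₗ[R] R, ∃ ψ : M →ₗ[R] R, ψ ∘ₗ N.subtype = φ) : N = ⊤ := by
  let e := LinearEquiv.ofInjective f hf
  rw [← Submodule.map_eq_top_iff (e := e)]
  refine eq_top_of_forall_exists_extension_ideal hGor (mt Submodule.map_eq_bot_iff.1 hN) fun φ => ?_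
  obtain ⟨ψ, hψ⟩ := h (φ ∘ₗ (e.submoduleMap N).toLinearMap)
  refine ⟨ψ ∘ₗ e.symm.toLinearMap, ?_⟩
  ext ⟨_, y, hy, rfl⟩
  have hψy : ψ y = φ (e.submoduleMap N ⟨y, hy⟩) := LinearMap.congr_fun hψ ⟨y, hy⟩
  rw [LinearMap.comp_apply, LinearMap.comp_apply]
  exact (congrArg ψ (e.symm_apply_apply y)).trans hψy

end Gorenstein

section Trace

variable {R : Type u} [CommRing R]

theorem range_le_moduleTrace {M : Type v} [AddCommGroup M] [Module R M] (φ : M →ₗ[R] R) :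
    LinearMap.range φ ≤ moduleTrace R M :=
  le_iSup (fun φ : M →ₗ[R] R => LinearMap.range φ) φ

theorem IsTraceIdeal.apply_mem {I : Ideal R} (hI : IsTraceIdeal I) (φ : I →ₗ[R] R) (x : I) :
    φ x ∈ I := by
  obtain ⟨M, _, _, -, rfl⟩ := hI
  have mem_trace (ψ : M →ₗ[R] R) (y : M) : ψ y ∈ moduleTrace R M := range_le_moduleTrace ψ ⟨y, rfl⟩
  have trace_le : moduleTrace R M ≤
      Submodule.map (Submodule.subtype _) (Submodule.comap φ (moduleTrace R M)) := by
    refine iSup_le fun ψ => ?_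
    rintro _ ⟨y, rfl⟩
    exact ⟨⟨ψ y, mem_trace ψ y⟩, mem_trace (φ ∘ₗ ψ.codRestrict _ (mem_trace ψ)) y, rfl⟩
  obtain ⟨x', hx', hx⟩ := trace_le x.2
  obtain rfl : x' = x := Subtype.ext hx
  exact hx'

theorem isTraceIdeal_iff_forall_apply_mem [IsNoetherianRing R] {I : Ideal R} :
    IsTraceIdeal I ↔ ∀ (φ : I →ₗ[R] R) (x : I), φ x ∈ I := by
  refine ⟨IsTraceIdeal.apply_mem, fun h => ⟨I, inferInstance, inferInstance, inferInstance,
    le_antisymm ?_ (iSup_le ?_)⟩⟩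
  · exact I.range_subtype.ge.trans (range_le_moduleTrace I.subtype)
  · rintro φ _ ⟨x, rfl⟩
    exact h φ x

theorem coe_mul_apply_comm {I : Ideal R} (φ : I →ₗ[R] R) (x y : I) :
    (x : R) * φ y = y * φ x := by
  rw [← smul_eq_mul, ← smul_eq_mul, ← map_smul, ← map_smul]
  exact congrArg φ (Subtype.ext (mul_comm _ _))

theorem IsTraceIdeal.mem_of_forall_dvd [IsDomain R] {I : Ideal R} (hI : IsTraceIdeal I) {x z : R}
    (hx : x ≠ 0) (hxI : x ∈ I) (h : ∀ i ∈ I, x ∣ z * i) : z ∈ I := by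
  have hinj : Injective (LinearMap.mulLeft R x) := mul_right_injective₀ hx
  let φ : I →ₗ[R] R := (LinearMap.mulLeft R z ∘ₗ I.subtype).codRestrictOfInjective _ hinj
    fun i => (h i i.2).imp fun _ => Eq.symm
  have hφ : x * φ ⟨x, hxI⟩ = z * x := LinearMap.codRestrictOfInjective_comp_apply _ _ hinj _ _
  rw [mul_comm z, mul_right_inj' hx] at hφ
  exact hφ ▸ hI.apply_mem φ ⟨x, hxI⟩

end Trace

section Dual

variable {R : Type u} [CommRing R] {B : Type v} [CommRing B] [Algebra R B]

/-- The `R`-dual of a submodule `N` of an overring `B`, as the ideal of those `r : R` with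
`r N ⊆ R`. The dual of `⊤` is the conductor of `R` in `B`. -/
def dualIdeal (N : Submodule R B) : Ideal R :=
  (1 / N).comap (Algebra.linearMap R B)

theorem mem_dualIdeal {N : Submodule R B} {r : R} :
    r ∈ dualIdeal N ↔ ∀ b ∈ N, algebraMap R B r * b ∈ (1 : Submodule R B) :=
  Submodule.mem_div_iff_forall_mul_mem

theorem dualIdeal_anti {M N : Submodule R B} (h : M ≤ N) : dualIdeal N ≤ dualIdeal M :=
  fun _ hr => mem_dualIdeal.2 fun b hb => mem_dualIdeal.1 hr b (h hb)

theorem inf_dualIdeal_le (M N : Submodule R B) :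
    dualIdeal M ⊓ dualIdeal N ≤ dualIdeal (M ⊔ N) := by
  rintro r ⟨hM, hN⟩
  rw [mem_dualIdeal]
  intro b hb
  obtain ⟨x, hx, y, hy, rfl⟩ := Submodule.mem_sup.1 hb
  rw [mul_add]
  exact add_mem (mem_dualIdeal.1 hM x hx) (mem_dualIdeal.1 hN y hy)

variable [FaithfulSMul R B]

theorem exists_linearMap_of_mem_dualIdeal {N : Submodule R B} {r : R} (hr : r ∈ dualIdeal N) :
    ∃ ψ : N →ₗ[R] R, ∀ n : N, algebraMap R B (ψ n) = algebraMap R B r * n := by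
  have hinj : Injective (Algebra.linearMap R B) := FaithfulSMul.algebraMap_injective R B
  have hmul (n : N) : (LinearMap.mulLeft R (algebraMap R B r) ∘ₗ N.subtype) n ∈
      LinearMap.range (Algebra.linearMap R B) :=
    Submodule.one_eq_range (R := R) (A := B) ▸ mem_dualIdeal.1 hr n n.2
  exact ⟨_, LinearMap.codRestrictOfInjective_comp_apply _ _ hinj hmul⟩

variable [IsDomain B]

theorem isTraceIdeal_dualIdeal [IsNoetherianRing R] (S : Subalgebra R B) :
    IsTraceIdeal (dualIdeal (Subalgebra.toSubmodule S)) := by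
  have hinj := FaithfulSMul.algebraMap_injective R B
  refine isTraceIdeal_iff_forall_apply_mem.2 fun φ a => mem_dualIdeal.2 fun b hb => ?_
  obtain ha | ha := eq_or_ne a 0
  · simp only [ha, map_zero, zero_mul, zero_mem]
  obtain ⟨a', ha'⟩ := Submodule.mem_one.1 (mem_dualIdeal.1 a.2 b hb)
  have ha'D : a' ∈ dualIdeal (Subalgebra.toSubmodule S) := mem_dualIdeal.2 fun t ht => by
    rw [ha', mul_assoc]
    exact mem_dualIdeal.1 a.2 _ (S.mul_mem hb ht)
  refine Submodule.mem_one.2 ⟨φ ⟨a', ha'D⟩, ?_⟩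
  have ha0 : algebraMap R B a ≠ 0 := (map_ne_zero_iff _ hinj).2 (by simpa using ha)
  have hcomm := congrArg (algebraMap R B) (coe_mul_apply_comm φ a ⟨a', ha'D⟩)
  refine mul_left_cancel₀ ha0 ?_
  rw [← map_mul, hcomm, map_mul, ha', mul_assoc, mul_comm b]

theorem algebraMap_apply_eq_mul (hcond : dualIdeal (⊤ : Submodule R B) ≠ ⊥) {N : Submodule R B}
    (h1 : 1 ∈ N) (φ : N →ₗ[R] R) (n : N) :
    algebraMap R B (φ n) = algebraMap R B (φ ⟨1, h1⟩) * n := by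
  obtain ⟨c, hc, hc0⟩ := Submodule.exists_mem_ne_zero_of_ne_bot hcond
  obtain ⟨r, hr⟩ := Submodule.mem_one.1 (mem_dualIdeal.1 hc n trivial)
  have hsmul : c • n = r • (⟨1, h1⟩ : N) := Subtype.ext <| by
    simp only [Submodule.coe_smul, Algebra.smul_def, hr, mul_one]
  have hφ : c * φ n = r * φ ⟨1, h1⟩ := by
    rw [← smul_eq_mul, ← map_smul, hsmul, map_smul, smul_eq_mul]
  refine mul_left_cancel₀ ((map_ne_zero_iff _ (FaithfulSMul.algebraMap_injective R B)).2 hc0) ?_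
  rw [← map_mul, hφ, map_mul, hr]
  ring

variable [IsDomain R] [IsNoetherianRing R] [IsLocalRing R] [Ring.KrullDimLE 1 R]

theorem le_of_le_of_dualIdeal_le (hGor : IsGorensteinLocalRing R)
    (hcond : dualIdeal (⊤ : Submodule R B) ≠ ⊥) {S T : Submodule R B} (h1 : 1 ∈ S) (hST : S ≤ T)
    (h : dualIdeal S ≤ dualIdeal T) : T ≤ S := by
  have hinj := FaithfulSMul.algebraMap_injective R B
  obtain ⟨c, hc, hc0⟩ := Submodule.exists_mem_ne_zero_of_ne_bot hcond
  obtain ⟨f, hf⟩ := exists_linearMap_of_mem_dualIdeal (N := T)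
    (mem_dualIdeal.2 fun b _ => mem_dualIdeal.1 hc b trivial)
  have hf_inj : Injective f := fun x y hxy => Subtype.ext <|
    mul_left_cancel₀ ((map_ne_zero_iff _ hinj).2 hc0) (by rw [← hf, ← hf, hxy])
  let one : S.submoduleOf T := ⟨⟨1, hST h1⟩, h1⟩
  have hN : S.submoduleOf T ≠ ⊥ := (Submodule.ne_bot_iff _).2
    ⟨one, one.2, fun h0 => one_ne_zero (congrArg Subtype.val h0)⟩
  refine Submodule.comap_subtype_eq_top.1 (eq_top_of_forall_exists_extension hGor hf_inj hN ?_)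
  intro φ
  let e := Submodule.submoduleOfEquivOfLe hST
  have hφ := algebraMap_apply_eq_mul hcond h1 (φ ∘ₗ e.symm.toLinearMap)
  have hφ_mem : φ (e.symm ⟨1, h1⟩) ∈ dualIdeal S :=
    mem_dualIdeal.2 fun b hb => Submodule.mem_one.2 ⟨_, hφ ⟨b, hb⟩⟩
  obtain ⟨ψ, hψ⟩ := exists_linearMap_of_mem_dualIdeal (h hφ_mem)
  refine ⟨ψ, LinearMap.ext fun n => hinj ((hψ n).trans ?_)⟩
  exact (hφ (e n)).symm.trans (congrArg (fun n => algebraMap R B (φ n)) (e.symm_apply_apply n))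

theorem le_of_dualIdeal_le (hGor : IsGorensteinLocalRing R)
    (hcond : dualIdeal (⊤ : Submodule R B) ≠ ⊥) {S T : Submodule R B} (h1 : 1 ∈ S)
    (h : dualIdeal S ≤ dualIdeal T) : T ≤ S :=
  le_sup_right.trans <| le_of_le_of_dualIdeal_le hGor hcond h1 le_sup_left <|
    (le_inf le_rfl h).trans (inf_dualIdeal_le S T)

end Dual

section IntegralOverIdeal

variable {R : Type u} [CommRing R] {S : Type v} [CommRing S]

theorem IsIntegralOverIdeal.map (f : R →+* S) {I : Ideal R} {J : Ideal S} (hIJ : I ≤ J.comap f)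
    {x : R} (hx : IsIntegralOverIdeal I x) : IsIntegralOverIdeal J (f x) := by
  obtain ⟨n, a, hn, ha, h⟩ := hx
  refine ⟨n, fun i => f (a i), hn, fun i hi => ?_, ?_⟩
  · exact Ideal.le_comap_pow f i (Ideal.pow_right_mono hIJ i (ha i hi))
  · simpa only [map_add, map_sum, map_mul, map_pow, map_zero] using congrArg f h

theorem IsIntegrallyClosedIdeal.comap (f : R →+* S) {J : Ideal S}
    (hJ : IsIntegrallyClosedIdeal J) : IsIntegrallyClosedIdeal (J.comap f) :=
  fun _ hx => hJ _ (hx.map f le_rfl)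

theorem isIntegrallyClosedIdeal_of_valuationRing [IsDomain R] [ValuationRing R] (I : Ideal R) :
    IsIntegrallyClosedIdeal I := by
  rintro x ⟨n, a, -, ha, h⟩
  by_contra hx
  -- As `I ⊆ x 𝔪`, the integral equation would give `x ^ n ∈ x ^ n 𝔪`.
  have hI : I ≤ Ideal.span {x} * maximalIdeal R := fun i hi => by
    obtain ⟨y, rfl⟩ := (ValuationRing.dvd_total i x).resolve_left
      fun hix => hx (Ideal.mem_of_dvd I hix hi)
    have hy : ¬ IsUnit y := fun hy => hx ((Ideal.mul_unit_mem_iff_mem I hy).1 hi)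
    exact Ideal.mul_mem_mul (Ideal.mem_span_singleton_self x) hy
  have hterm (i : ℕ) (hi : i ∈ Finset.Icc 1 n) :
      a i * x ^ (n - i) ∈ Ideal.span {x ^ n} * maximalIdeal R := by
    obtain ⟨hi1, hin⟩ := Finset.mem_Icc.1 hi
    have hai := Ideal.pow_right_mono hI i (ha i hi)
    rw [mul_pow, Ideal.span_singleton_pow] at hai
    obtain ⟨w, hw, hwa⟩ := Ideal.mem_span_singleton_mul.1 hai
    refine Ideal.mem_span_singleton_mul.2
      ⟨w, Ideal.pow_le_self (Nat.one_le_iff_ne_zero.1 hi1) hw, ?_⟩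
    rw [← hwa, mul_right_comm, pow_mul_pow_sub x hin]
  have hpow : x ^ n ∈ Ideal.span {x ^ n} * maximalIdeal R := by
    rw [← neg_mem_iff, neg_eq_of_add_eq_zero_right h]
    exact sum_mem hterm
  obtain ⟨w, hw, hwx⟩ := Ideal.mem_span_singleton_mul.1 hpow
  have hxn : x ^ n ≠ 0 := pow_ne_zero n fun hx0 => hx (hx0 ▸ I.zero_mem)
  exact (Ideal.ne_top_iff_one _).1 (maximalIdeal.isMaximal R).ne_top
    ((mul_eq_left₀ hxn).1 hwx ▸ hw)

theorem IsIntegralOverIdeal.of_monic [Nontrivial R] {I : Ideal R} {x : R} {p : Polynomial R}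
    (hp : p.Monic) (hcoeff : ∀ i, p.coeff i ∈ I ^ (p.natDegree - i)) (hx : p.eval x = 0) :
    IsIntegralOverIdeal I x := by
  have hdeg : 0 < p.natDegree := Nat.pos_of_ne_zero fun h0 => one_ne_zero (α := R) <| by
    rwa [hp.natDegree_eq_zero.1 h0, Polynomial.eval_one] at hx
  refine ⟨p.natDegree, fun i => p.coeff (p.natDegree - i), hdeg, fun i hi => ?_, ?_⟩
  · have := hcoeff (p.natDegree - i)
    rwa [Nat.sub_sub_self (Finset.mem_Icc.1 hi).2] at this
  · rw [Polynomial.eval_eq_sum_range, Finset.sum_range_succ, hp.coeff_natDegree, one_mul,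
      add_comm] at hx
    rw [← hx, ← Finset.Ico_add_one_right_eq_Icc, Finset.sum_Ico_eq_sum_range, Nat.add_sub_cancel,
      ← Finset.sum_range_reflect fun i => p.coeff i * x ^ i]
    simp only [Nat.sub_sub]

theorem IsIntegrallyClosedIdeal.mem_of_algebraMap_dvd [Nontrivial R] [Algebra R S]
    [FaithfulSMul R S] [Algebra.IsIntegral R S] {I : Ideal R} (hI : IsIntegrallyClosedIdeal I)
    {x y : R} (hy : y ∈ I) (h : algebraMap R S y ∣ algebraMap R S x) : x ∈ I := by
  obtain ⟨b, hb⟩ := h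
  obtain ⟨p, hp, hpb⟩ := Algebra.IsIntegral.isIntegral (R := R) b
  refine hI x (.of_monic ((Polynomial.monic_scaleRoots_iff y).2 hp) (fun i => ?_)
    (FaithfulSMul.algebraMap_injective R S ?_))
  · rw [Polynomial.coeff_scaleRoots, Polynomial.natDegree_scaleRoots]
    exact Ideal.mul_mem_left _ _ (Ideal.pow_mem_pow hy _)
  · rw [← Polynomial.aeval_algebraMap_apply_eq_algebraMap_eval, hb, map_zero]
    exact Polynomial.scaleRoots_aeval_eq_zero hpb

end IntegralOverIdeal

section Valuation

variable {B : Type v} [CommRing B] [IsDomain B] [IsDiscreteValuationRing B]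

theorem mem_maximalIdeal_pow_iff {n : ℕ} {b : B} : b ∈ maximalIdeal B ^ n ↔ n ≤ addVal B b := by
  obtain ⟨ϖ, hϖ⟩ := exists_irreducible B
  rw [hϖ.maximalIdeal_eq, Ideal.span_singleton_pow, Ideal.mem_span_singleton, ← addVal_le_iff_dvd,
    hϖ.addVal_pow]

theorem exists_addVal_eq (n : ℕ) : ∃ b : B, addVal B b = n :=
  (exists_irreducible B).imp' (· ^ n) fun _ hϖ => hϖ.addVal_pow n

theorem exists_addVal_eq_natCast {b : B} (hb : b ≠ 0) : ∃ n : ℕ, addVal B b = n :=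
  ⟨_, (ENat.natCast_toNat (mt addVal_eq_top_iff.1 hb)).symm⟩

theorem ne_zero_of_addVal_eq_natCast {b : B} {n : ℕ} (h : addVal B b = n) : b ≠ 0 := by
  rintro rfl
  exact ENat.top_ne_natCast n (addVal_zero.symm.trans h)

theorem exists_addVal_eq_of_notMem {b : B} {n : ℕ} (h : b ∉ maximalIdeal B ^ n) :
    ∃ k < n, addVal B b = k := by
  obtain ⟨k, hk⟩ := exists_addVal_eq_natCast fun h0 : b = 0 => h (h0 ▸ zero_mem _)
  rw [mem_maximalIdeal_pow_iff, hk, not_le] at h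
  exact ⟨k, by exact_mod_cast h, hk⟩

theorem addVal_eq_of_mem_of_notMem {b : B} {n : ℕ} (h : b ∈ maximalIdeal B ^ n)
    (h' : b ∉ maximalIdeal B ^ (n + 1)) : addVal B b = n := by
  obtain ⟨k, hk, hb⟩ := exists_addVal_eq_of_notMem h'
  rw [mem_maximalIdeal_pow_iff, hb] at h
  rw [hb, le_antisymm (Nat.lt_succ_iff.1 hk) (by exact_mod_cast h)]

theorem notMem_of_addVal_eq {b : B} {n : ℕ} (h : addVal B b = n) :
    b ∉ maximalIdeal B ^ (n + 1) := by
  rw [mem_maximalIdeal_pow_iff, h, not_le]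
  exact_mod_cast n.lt_succ_self

theorem addVal_eq_of_sub_mem {b b' : B} {n : ℕ} (h : addVal B b = n)
    (hsub : b' - b ∈ maximalIdeal B ^ (n + 1)) : addVal B b' = n := by
  refine addVal_eq_of_mem_of_notMem ?_ fun hb' => notMem_of_addVal_eq h ?_
  · exact sub_add_cancel b' b ▸ add_mem (Ideal.pow_le_pow_right n.le_succ hsub)
      (mem_maximalIdeal_pow_iff.2 h.ge)
  · exact sub_sub_cancel b' b ▸ sub_mem hb' hsub

variable {R : Type u} [CommRing R] [Algebra R B]

theorem exists_sub_smul_mem (hres : Surjective (algebraMap R (ResidueField B))) {b u : B} {n : ℕ}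
    (hu : addVal B u = n) (hb : b ∈ maximalIdeal B ^ n) :
    ∃ r : R, b - r • u ∈ maximalIdeal B ^ (n + 1) := by
  obtain ⟨w, rfl⟩ := addVal_le_iff_dvd.1 (hu.trans_le (mem_maximalIdeal_pow_iff.1 hb))
  obtain ⟨r, hr⟩ := hres (residue B w)
  have hw : w - algebraMap R B r ∈ maximalIdeal B :=
    Ideal.Quotient.eq.1 (hr.symm.trans (IsScalarTower.algebraMap_apply R B _ r) : residue B w = _)
  refine ⟨r, ?_⟩
  rw [Algebra.smul_def, mul_comm _ u, ← mul_sub, pow_succ]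
  exact Ideal.mul_mem_mul (mem_maximalIdeal_pow_iff.2 hu.ge) hw

theorem le_of_forall_exists_addVal_eq (hres : Surjective (algebraMap R (ResidueField B)))
    {A : Type*} [AddCommGroup A] [Module R A] (f : A →ₗ[R] B) {M N : Submodule R A} {c : ℕ}
    (hN : ((maximalIdeal B ^ c).restrictScalars R).comap f ≤ N)
    (h : ∀ y ∈ M, ∀ n < c, addVal B (f y) = n → ∃ y' ∈ M ⊓ N, addVal B (f y') = n) : M ≤ N := by
  suffices ∀ y ∈ M, f y ∈ maximalIdeal B ^ 0 → y ∈ N from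
    fun y hy => this y hy (by simp only [pow_zero, Ideal.one_eq_top, Submodule.mem_top])
  refine Nat.decreasingInduction (motive := fun n _ => ∀ y ∈ M, f y ∈ maximalIdeal B ^ n → y ∈ N)
    (fun n hn ih y hy hyn => ?_) (fun y _ hyc => hN hyc) (Nat.zero_le c)
  by_cases hyn' : f y ∈ maximalIdeal B ^ (n + 1)
  · exact ih y hy hyn'
  obtain ⟨y', ⟨hy'M, hy'N⟩, hy'⟩ := h y hy n hn (addVal_eq_of_mem_of_notMem hyn hyn')
  obtain ⟨r, hr⟩ := exists_sub_smul_mem hres hy' hyn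
  rw [← map_smul, ← map_sub] at hr
  exact sub_add_cancel y (r • y') ▸
    add_mem (ih _ (sub_mem hy (M.smul_mem r hy'M)) hr) (N.smul_mem r hy'N)

theorem exists_addVal_eq_and_le_comap [FaithfulSMul R B] {I : Ideal R} (hI : I ≠ ⊥) :
    ∃ x ∈ I, ∃ m : ℕ, addVal B (algebraMap R B x) = m ∧
      I ≤ (maximalIdeal B ^ m).comap (algebraMap R B) := by
  have hinj := FaithfulSMul.algebraMap_injective R B
  obtain ⟨x, hx, hmin⟩ := exists_minimalFor_of_wellFoundedLT (· ∈ I)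
    (fun x => addVal B (algebraMap R B x)) ⟨0, I.zero_mem⟩
  have hle (i : R) (hi : i ∈ I) : addVal B (algebraMap R B x) ≤ addVal B (algebraMap R B i) :=
    (le_total _ _).elim id (hmin hi)
  have hx0 : algebraMap R B x ≠ 0 := fun h0 => hI <| eq_bot_iff.2 fun i hi => by
    have := hle i hi
    rwa [h0, addVal_zero, top_le_iff, addVal_eq_top_iff, map_eq_zero_iff _ hinj] at this
  obtain ⟨m, hm⟩ := exists_addVal_eq_natCast hx0
  exact ⟨x, hx, m, hm, fun i hi => mem_maximalIdeal_pow_iff.2 (hm.ge.trans (hle i hi))⟩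

end Valuation

section Conductor

variable {R : Type u} [CommRing R] {B : Type v} [CommRing B] [IsDomain B]
  [IsDiscreteValuationRing B] [Algebra R B]

theorem dualIdeal_top_ne_bot {c : ℕ} (hc : (maximalIdeal B ^ c).restrictScalars R ≤ 1) :
    dualIdeal (⊤ : Submodule R B) ≠ ⊥ := by
  obtain ⟨b, hb⟩ := exists_addVal_eq (B := B) c
  obtain ⟨r, rfl⟩ := Submodule.mem_one.1 (hc (mem_maximalIdeal_pow_iff.2 hb.ge))
  have hr : r ∈ dualIdeal (⊤ : Submodule R B) := mem_dualIdeal.2 fun b _ =>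
    hc (Ideal.mul_mem_right b _ (mem_maximalIdeal_pow_iff.2 hb.ge))
  refine (Submodule.ne_bot_iff _).2 ⟨r, hr, fun h0 => ne_zero_of_addVal_eq_natCast hb ?_⟩
  rw [h0, map_zero]

theorem exists_maximalIdeal_pow_le_one [FaithfulSMul R B]
    (hcond : dualIdeal (⊤ : Submodule R B) ≠ ⊥) :
    ∃ c : ℕ, (maximalIdeal B ^ c).restrictScalars R ≤ 1 := by
  obtain ⟨r, hr, hr0⟩ := Submodule.exists_mem_ne_zero_of_ne_bot hcond
  obtain ⟨c, hc⟩ := exists_addVal_eq_natCast <|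
    (map_ne_zero_iff _ (FaithfulSMul.algebraMap_injective R B)).2 hr0
  refine ⟨c, fun b hb => ?_⟩
  obtain ⟨w, rfl⟩ := addVal_le_iff_dvd.1 (hc.trans_le (mem_maximalIdeal_pow_iff.1 hb))
  exact mem_dualIdeal.1 hr w trivial

variable [IsDomain R]

theorem mem_valueSemigroup {n : ℕ} :
    n ∈ valueSemigroup R B ↔ ∃ r : R, addVal B (algebraMap R B r) = n := by
  refine ⟨fun ⟨r, _, hr⟩ => ⟨r, hr⟩, fun ⟨r, hr⟩ => ⟨r, ?_, hr⟩⟩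
  rintro rfl
  exact ne_zero_of_addVal_eq_natCast hr (map_zero _)

theorem mem_valueSemigroup_of_le {c n : ℕ} (hc : (maximalIdeal B ^ c).restrictScalars R ≤ 1)
    (hn : c ≤ n) : n ∈ valueSemigroup R B := by
  obtain ⟨b, hb⟩ := exists_addVal_eq (B := B) n
  have hbc : b ∈ maximalIdeal B ^ c := Ideal.pow_le_pow_right hn (mem_maximalIdeal_pow_iff.2 hb.ge)
  obtain ⟨r, rfl⟩ := Submodule.mem_one.1 (hc hbc)
  exact mem_valueSemigroup.2 ⟨r, hb⟩

theorem maximalIdeal_pow_le_one_of_forall_mem (hres : Surjective (algebraMap R (ResidueField B)))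
    {C c : ℕ} (hC : (maximalIdeal B ^ C).restrictScalars R ≤ 1)
    (h : ∀ n, c ≤ n → n ∈ valueSemigroup R B) : (maximalIdeal B ^ c).restrictScalars R ≤ 1 := by
  refine le_of_forall_exists_addVal_eq hres LinearMap.id hC fun y hy n _ hn => ?_
  have hcn : (c : ℕ∞) ≤ n := hn ▸ mem_maximalIdeal_pow_iff.1 hy
  obtain ⟨r, hr⟩ := mem_valueSemigroup.1 (h n (by exact_mod_cast hcn))
  exact ⟨algebraMap R B r, ⟨mem_maximalIdeal_pow_iff.2 (hcn.trans_eq hr.symm),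
    Submodule.mem_one.2 ⟨r, rfl⟩⟩, hr⟩

variable [FaithfulSMul R B]

theorem IsTraceIdeal.comap_maximalIdeal_pow_le_of_conductor {I : Ideal R} (hI : IsTraceIdeal I)
    (hI0 : I ≠ ⊥) {c : ℕ} (hc : (maximalIdeal B ^ c).restrictScalars R ≤ 1) :
    (maximalIdeal B ^ c).comap (algebraMap R B) ≤ I := by
  intro r hr
  obtain ⟨x, hx, m, hm, hle⟩ := exists_addVal_eq_and_le_comap (B := B) hI0
  refine hI.mem_of_forall_dvd (ne_zero_of_map (ne_zero_of_addVal_eq_natCast hm)) hx fun i hi => ?_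
  obtain ⟨b, hb⟩ := addVal_le_iff_dvd.1 (hm.trans_le (mem_maximalIdeal_pow_iff.1 (hle hi)))
  obtain ⟨s, hs⟩ := Submodule.mem_one.1 (hc (Ideal.mul_mem_right b _ hr))
  refine ⟨s, FaithfulSMul.algebraMap_injective R B ?_⟩
  rw [map_mul, map_mul, hb, hs, mul_left_comm]

theorem IsIntegrallyClosedIdeal.eq_comap [Algebra.IsIntegral R B] {I : Ideal R}
    (hI : IsIntegrallyClosedIdeal I) {x : R} (hx : x ∈ I) {m : ℕ}
    (hm : addVal B (algebraMap R B x) = m) (hle : I ≤ (maximalIdeal B ^ m).comap (algebraMap R B)) :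
    I = (maximalIdeal B ^ m).comap (algebraMap R B) :=
  hle.antisymm fun _ hr => hI.mem_of_algebraMap_dvd hx <|
    addVal_le_iff_dvd.1 (hm.trans_le (mem_maximalIdeal_pow_iff.1 hr))

theorem finite_isTraceIdeal_of_isIntegrallyClosedIdeal [Algebra.IsIntegral R B] {c : ℕ}
    (hc : (maximalIdeal B ^ c).restrictScalars R ≤ 1)
    (h : ∀ I : Ideal R, IsTraceIdeal I → IsIntegrallyClosedIdeal I) :
    {I : Ideal R | IsTraceIdeal I}.Finite := by
  refine (((Set.finite_Iic c).image fun n => (maximalIdeal B ^ n).comap (algebraMap R B)).insert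
    ⊥).subset fun I (hI : IsTraceIdeal I) => ?_
  obtain hI0 | hI0 := eq_or_ne I ⊥
  · exact Or.inl hI0
  obtain ⟨x, hx, m, hm, hle⟩ := exists_addVal_eq_and_le_comap (B := B) hI0
  refine Or.inr ⟨m, ?_, ((h I hI).eq_comap hx hm hle).symm⟩
  obtain ⟨r, hr⟩ := mem_valueSemigroup.1 (mem_valueSemigroup_of_le hc le_rfl)
  have hrI := hI.comap_maximalIdeal_pow_le_of_conductor hI0 hc (mem_maximalIdeal_pow_iff.2 hr.ge)
  have := mem_maximalIdeal_pow_iff.1 (hle hrI)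
  rw [hr] at this
  exact_mod_cast this

end Conductor

section IntegrallyClosedTrace

variable {R : Type u} [CommRing R] [IsDomain R] {B : Type v} [CommRing B] [IsDomain B]
  [IsDiscreteValuationRing B] [Algebra R B] [FaithfulSMul R B]

theorem IsTraceIdeal.comap_maximalIdeal_pow_le_of_le_sup {I : Ideal R} (hI : IsTraceIdeal I)
    {c m : ℕ} (hc : (maximalIdeal B ^ c).restrictScalars R ≤ 1) {x : R} (hx : x ∈ I)
    (hm : addVal B (algebraMap R B x) = m)
    (hle : I ≤ Ideal.span {x} ⊔ (maximalIdeal B ^ c).comap (algebraMap R B)) :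
    (maximalIdeal B ^ m).comap (algebraMap R B) ≤ I := by
  refine fun z hz => hI.mem_of_forall_dvd (ne_zero_of_map (ne_zero_of_addVal_eq_natCast hm)) hx
    fun i hi => ?_
  obtain ⟨w, hw⟩ := addVal_le_iff_dvd.1 (hm.trans_le (mem_maximalIdeal_pow_iff.1 hz))
  obtain ⟨y, hy, e, he, rfl⟩ := Submodule.mem_sup.1 (hle hi)
  obtain ⟨r, rfl⟩ := Ideal.mem_span_singleton.1 hy
  obtain ⟨s, hs⟩ := Submodule.mem_one.1 (hc (Ideal.mul_mem_left _ w he))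
  refine ⟨z * r + s, FaithfulSMul.algebraMap_injective R B ?_⟩
  simp only [map_mul, map_add, hw, hs]
  ring

theorem IsTraceIdeal.comap_maximalIdeal_pow_le
    (hres : Surjective (algebraMap R (ResidueField B))) {I : Ideal R} (hI : IsTraceIdeal I)
    {c m : ℕ} (hc : (maximalIdeal B ^ c).restrictScalars R ≤ 1) {x : R} (hx : x ∈ I)
    (hm : addVal B (algebraMap R B x) = m) (hle : I ≤ (maximalIdeal B ^ m).comap (algebraMap R B))
    (hH : (((valueSemigroup R B : Set ℕ) ∩ Set.Ico m c) \
      (m + ·) '' (valueSemigroup R B : Set ℕ)).Subsingleton) :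
    (maximalIdeal B ^ m).comap (algebraMap R B) ≤ I := by
  have hI0 : I ≠ ⊥ := (Submodule.ne_bot_iff _).2
    ⟨x, hx, ne_zero_of_map (ne_zero_of_addVal_eq_natCast hm)⟩
  have exists_mul (h : ℕ) (hh : h ∈ valueSemigroup R B) :
      ∃ r : R, addVal B (algebraMap R B (x * r)) = (m + h : ℕ) := by
    obtain ⟨r, hr⟩ := mem_valueSemigroup.1 hh
    exact ⟨r, by rw [map_mul, addVal_mul, hm, hr, Nat.cast_add]⟩
  have mem_Ico {r : R} (hr : algebraMap R B r ∈ maximalIdeal B ^ m) {n : ℕ} (hnc : n < c)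
      (hn : addVal B (algebraMap R B r) = n) :
      n ∈ (valueSemigroup R B : Set ℕ) ∩ Set.Ico m c := by
    have hmn := mem_maximalIdeal_pow_iff.1 hr
    rw [hn] at hmn
    exact ⟨mem_valueSemigroup.2 ⟨r, hn⟩, by exact_mod_cast hmn, hnc⟩
  by_cases h : ∀ i ∈ I, ∀ n < c, addVal B (algebraMap R B i) = n →
      n ∈ (m + ·) '' (valueSemigroup R B : Set ℕ)
  · refine hI.comap_maximalIdeal_pow_le_of_le_sup hc hx hm ?_
    refine le_of_forall_exists_addVal_eq hres (Algebra.linearMap R B) (c := c)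
      (fun _ hr => Submodule.mem_sup_right hr) fun i hi n hnc hn => ?_
    obtain ⟨h, hh, rfl⟩ := h i hi n hnc hn
    obtain ⟨r, hr⟩ := exists_mul h hh
    exact ⟨x * r, ⟨I.mul_mem_right r hx, Submodule.mem_sup_left <|
      Ideal.mul_mem_right r _ (Ideal.mem_span_singleton_self x)⟩, hr⟩
  · push Not at h
    obtain ⟨i, hi, p, hpc, hp, hpH⟩ := h
    refine le_of_forall_exists_addVal_eq hres (Algebra.linearMap R B)
      (hI.comap_maximalIdeal_pow_le_of_conductor hI0 hc) fun r hr n hnc hn => ?_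
    suffices ∃ j ∈ I, addVal B (algebraMap R B j) = n from
      this.imp fun j hj => ⟨⟨hle hj.1, hj.1⟩, hj.2⟩
    by_cases hnH : n ∈ (m + ·) '' (valueSemigroup R B : Set ℕ)
    · obtain ⟨h, hh, rfl⟩ := hnH
      exact (exists_mul h hh).imp' (x * ·) fun r hr => ⟨I.mul_mem_right r hx, hr⟩
    · obtain rfl : p = n := hH ⟨mem_Ico (hle hi) hpc hp, hpH⟩ ⟨mem_Ico hr hnc hn, hnH⟩
      exact ⟨i, hi, hp⟩

theorem IsTraceIdeal.isIntegrallyClosedIdeal (hres : Surjective (algebraMap R (ResidueField B)))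
    {c : ℕ} (hc : (maximalIdeal B ^ c).restrictScalars R ≤ 1)
    (hH : ∀ m ∈ valueSemigroup R B, (((valueSemigroup R B : Set ℕ) ∩ Set.Ico m c) \
      (m + ·) '' (valueSemigroup R B : Set ℕ)).Subsingleton)
    {I : Ideal R} (hI : IsTraceIdeal I) : IsIntegrallyClosedIdeal I := by
  suffices ∃ J : Ideal B, I = J.comap (algebraMap R B) by
    obtain ⟨J, rfl⟩ := this
    exact (isIntegrallyClosedIdeal_of_valuationRing J).comap _
  obtain rfl | hI0 := eq_or_ne I ⊥
  · exact ⟨⊥, ((RingHom.injective_iff_ker_eq_bot _).1 (FaithfulSMul.algebraMap_injective R B)).symm⟩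
  obtain ⟨x, hx, m, hm, hle⟩ := exists_addVal_eq_and_le_comap (B := B) hI0
  exact ⟨_, hle.antisymm <| hI.comap_maximalIdeal_pow_le hres hc hx hm hle <|
    hH m (mem_valueSemigroup.2 ⟨x, hm⟩)⟩

end IntegrallyClosedTrace

section Symmetry

variable {R : Type u} [CommRing R] [IsDomain R] {B : Type v} [CommRing B] [IsDomain B]
  [IsDiscreteValuationRing B] [Algebra R B]

theorem mem_maximalIdeal_pow_succ {r : R} {n : ℕ} (hr : algebraMap R B r ∈ maximalIdeal B ^ n)
    (hn : n ∉ valueSemigroup R B) : algebraMap R B r ∈ maximalIdeal B ^ (n + 1) := by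
  by_contra h
  exact hn (mem_valueSemigroup.2 ⟨r, addVal_eq_of_mem_of_notMem hr h⟩)

theorem mem_valueSemigroup_of_mem_dualIdeal {r : R} {j k n : ℕ}
    (hr : r ∈ dualIdeal ((maximalIdeal B ^ k).restrictScalars R))
    (hj : addVal B (algebraMap R B r) = j) (hn : j + k ≤ n) : n ∈ valueSemigroup R B := by
  obtain ⟨b, hb⟩ := exists_addVal_eq (B := B) (n - j)
  have hbk : b ∈ maximalIdeal B ^ k :=
    Ideal.pow_le_pow_right (Nat.le_sub_of_add_le' hn) (mem_maximalIdeal_pow_iff.2 hb.ge)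
  obtain ⟨s, hs⟩ := Submodule.mem_one.1 (mem_dualIdeal.1 hr b hbk)
  refine mem_valueSemigroup.2 ⟨s, ?_⟩
  rw [hs, addVal_mul, hj, hb, ← Nat.cast_add, Nat.add_sub_cancel' (Nat.le_of_add_right_le hn)]

theorem dualIdeal_maximalIdeal_pow_succ_le {g h : ℕ}
    (hc : (maximalIdeal B ^ (g + h + 1)).restrictScalars R ≤ 1)
    (hgh : g + h ∉ valueSemigroup R B) (hh : h ∉ valueSemigroup R B) :
    dualIdeal ((maximalIdeal B ^ (g + 1)).restrictScalars R) ≤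
      dualIdeal ((maximalIdeal B ^ g).restrictScalars R) := by
  intro r hr
  have hrh : algebraMap R B r ∈ maximalIdeal B ^ (h + 1) := by
    by_contra hrh
    obtain ⟨j, hjh, hj⟩ := exists_addVal_eq_of_notMem hrh
    have hne : j ≠ h := fun hjh => hh (hjh ▸ mem_valueSemigroup.2 ⟨r, hj⟩)
    exact hgh (mem_valueSemigroup_of_mem_dualIdeal hr hj (by lia))
  refine mem_dualIdeal.2 fun b hb => hc ?_
  rw [show g + h + 1 = h + 1 + g by ring, pow_add]
  exact Ideal.mul_mem_mul hrh hb

variable [IsNoetherianRing R] [IsLocalRing R] [Ring.KrullDimLE 1 R] [FaithfulSMul R B]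

theorem mem_valueSemigroup_of_isGorenstein (hGor : IsGorensteinLocalRing R) {g h : ℕ}
    (hc : (maximalIdeal B ^ (g + h + 1)).restrictScalars R ≤ 1)
    (hgh : g + h ∉ valueSemigroup R B) (hg : g ∉ valueSemigroup R B) : h ∈ valueSemigroup R B := by
  by_contra hh
  -- If `h` were a gap too, `R + 𝔫 ^ g` and `R + 𝔫 ^ (g + 1)` would have the same dual.
  let N : Submodule R B := 1 ⊔ (maximalIdeal B ^ (g + 1)).restrictScalars R
  have hdual : dualIdeal N ≤ dualIdeal ((maximalIdeal B ^ g).restrictScalars R) :=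
    (dualIdeal_anti le_sup_right).trans (dualIdeal_maximalIdeal_pow_succ_le hc hgh hh)
  have hle : (maximalIdeal B ^ g).restrictScalars R ≤ N := le_of_dualIdeal_le hGor
    (dualIdeal_top_ne_bot hc) (Submodule.mem_sup_left (Submodule.mem_one.2 ⟨1, map_one _⟩)) hdual
  obtain ⟨b, hb⟩ := exists_addVal_eq (B := B) g
  obtain ⟨a, ha, e, he, rfl⟩ := Submodule.mem_sup.1 (hle (mem_maximalIdeal_pow_iff.2 hb.ge))
  obtain ⟨r, rfl⟩ := Submodule.mem_one.1 ha
  refine hg (mem_valueSemigroup.2 ⟨r, addVal_eq_of_sub_mem hb ?_⟩)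
  rw [sub_add_cancel_left]
  exact neg_mem he

end Symmetry

section Overring

variable {R : Type u} [CommRing R] {B : Type v} [CommRing B] [IsLocalRing B] [Algebra R B]

/-- The overring `R + R u + 𝔫 ^ k` of `R`, where `𝔫` is the maximal ideal of `B` and
`u ^ 2 ∈ 𝔫 ^ k`. Overrings of this shape yield infinitely many trace ideals. -/
def overring (R : Type u) [CommRing R] [Algebra R B] (u : B) (k : ℕ)
    (hu : u ^ 2 ∈ maximalIdeal B ^ k) : Subalgebra R B where
  carrier := {b | ∃ r s : R, b - (algebraMap R B r + s • u) ∈ maximalIdeal B ^ k}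
  algebraMap_mem' r := ⟨r, 0, by simp⟩
  add_mem' := by
    rintro a b ⟨r, s, ha⟩ ⟨r', s', hb⟩
    refine ⟨r + r', s + s', ?_⟩
    convert add_mem ha hb using 1
    rw [map_add, add_smul]
    ring
  mul_mem' := by
    rintro a b ⟨r, s, ha⟩ ⟨r', s', hb⟩
    refine ⟨r * r', r * s' + s * r', ?_⟩
    convert add_mem (add_mem (Ideal.mul_mem_right b _ ha)
      (Ideal.mul_mem_left _ (algebraMap R B r + s • u) hb))
      (Ideal.mul_mem_left _ (algebraMap R B (s * s')) hu) using 1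
    simp only [Algebra.smul_def, map_add, map_mul]
    ring

end Overring

section ConsecutiveGaps

variable {R : Type u} [CommRing R] [IsDomain R] {B : Type v} [CommRing B] [IsDomain B]
  [IsDiscreteValuationRing B] [Algebra R B]

theorem mem_maximalIdeal_pow_of_mem_overring {u : B} {p : ℕ} (hu : addVal B u = p)
    (hu2 : u ^ 2 ∈ maximalIdeal B ^ (p + 2)) (hp : p ∉ valueSemigroup R B)
    (hp' : p + 1 ∉ valueSemigroup R B) {y : B} (hy : y ∈ overring R u (p + 2) hu2)
    (hyp : y ∈ maximalIdeal B ^ (p + 1)) : y ∈ maximalIdeal B ^ (p + 2) := by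
  obtain ⟨r, s, he⟩ := hy
  have hup : u ∈ maximalIdeal B ^ p := mem_maximalIdeal_pow_iff.2 hu.ge
  have hsum : algebraMap R B r + s • u ∈ maximalIdeal B ^ (p + 1) :=
    sub_sub_cancel y (algebraMap R B r + s • u) ▸
      sub_mem hyp (Ideal.pow_le_pow_right (Nat.le_succ _) he)
  have hsu : s • u ∈ maximalIdeal B ^ p := Submodule.smul_of_tower_mem _ s hup
  have hr : algebraMap R B r ∈ maximalIdeal B ^ p :=
    (Ideal.add_mem_iff_left _ hsu).1 (Ideal.pow_le_pow_right (Nat.le_succ _) hsum)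
  have hr2 : algebraMap R B r ∈ maximalIdeal B ^ (p + 2) :=
    mem_maximalIdeal_pow_succ (mem_maximalIdeal_pow_succ hr hp) hp'
  have hsu1 : s • u ∈ maximalIdeal B ^ (p + 1) :=
    (Ideal.add_mem_iff_right _ (Ideal.pow_le_pow_right (Nat.le_succ _) hr2)).1 hsum
  have h1 : 1 ∉ valueSemigroup R B := fun h1 => hp (by simpa using nsmul_mem h1 p)
  have hs1 : algebraMap R B s ∈ maximalIdeal B ^ 1 := by
    rw [mem_maximalIdeal_pow_iff, Algebra.smul_def, addVal_mul, hu, add_comm, Nat.cast_add] at hsu1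
    exact mem_maximalIdeal_pow_iff.2 ((ENat.add_le_add_iff_right (ENat.natCast_ne_top p)).1 hsu1)
  have hsu2 : s • u ∈ maximalIdeal B ^ (p + 2) := by
    rw [add_comm, pow_add, Algebra.smul_def]
    exact Ideal.mul_mem_mul (mem_maximalIdeal_pow_succ hs1 h1) hup
  exact sub_add_cancel y (algebraMap R B r + s • u) ▸ add_mem he (add_mem hr2 hsu2)

variable [IsNoetherianRing R] [IsLocalRing R] [Ring.KrullDimLE 1 R] [FaithfulSMul R B]

theorem infinite_isTraceIdeal [Infinite (ResidueField R)] (hGor : IsGorensteinLocalRing R)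
    (hcond : dualIdeal (⊤ : Submodule R B) ≠ ⊥) {p : ℕ} (hp2 : 2 ≤ p)
    (hp : p ∉ valueSemigroup R B) (hp' : p + 1 ∉ valueSemigroup R B) :
    {I : Ideal R | IsTraceIdeal I}.Infinite := by
  obtain ⟨t, ht⟩ := exists_addVal_eq (B := B) p
  obtain ⟨t', ht'⟩ := exists_addVal_eq (B := B) (p + 1)
  have ht'_mem : t' ∈ maximalIdeal B ^ (p + 1) := mem_maximalIdeal_pow_iff.2 ht'.ge
  let u (l : R) : B := t + l • t'
  have hu (l : R) : addVal B (u l) = p := addVal_eq_of_sub_mem ht <| by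
    rw [add_sub_cancel_left]
    exact Submodule.smul_of_tower_mem _ l ht'_mem
  have hu2 (l : R) : u l ^ 2 ∈ maximalIdeal B ^ (p + 2) := by
    rw [mem_maximalIdeal_pow_iff, addVal_pow, hu, nsmul_eq_mul]
    exact_mod_cast (by lia : p + 2 ≤ 2 * p)
  let S (l : R) : Subalgebra R B := overring R (u l) (p + 2) (hu2 l)
  have huS (l : R) : u l ∈ S l := ⟨0, 1, by simp⟩
  let lift : ResidueField R → R := surjInv residue_surjective
  refine Set.infinite_of_injective_forall_mem
    (f := fun x => dualIdeal (Subalgebra.toSubmodule (S (lift x)))) (fun x y hxy => ?_)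
    fun x => isTraceIdeal_dualIdeal _
  by_contra hne
  have huy : u (lift x) ∈ S (lift y) :=
    le_of_dualIdeal_le hGor hcond (S (lift y)).one_mem hxy.ge (huS (lift x))
  have hdiff : u (lift x) - u (lift y) = (lift x - lift y) • t' := by
    rw [add_sub_add_left_eq_sub, sub_smul]
  have hunit : IsUnit (lift x - lift y) := by
    rw [← residue_ne_zero_iff_isUnit, map_sub, surjInv_eq residue_surjective,
      surjInv_eq residue_surjective]
    exact sub_ne_zero.2 hne
  have hval : addVal B (u (lift x) - u (lift y)) = (p + 1 : ℕ) := by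
    rw [hdiff, Algebra.smul_def, addVal_mul, ht',
      addVal_eq_zero_iff.2 (hunit.map (algebraMap R B)), zero_add]
  exact notMem_of_addVal_eq hval <| mem_maximalIdeal_pow_of_mem_overring (hu (lift y))
    (hu2 (lift y)) hp hp' (sub_mem huy (huS (lift y))) (mem_maximalIdeal_pow_iff.2 hval.ge)

end ConsecutiveGaps

section NumericalSemigroup

theorem mem_closure_two_iff {a p : ℕ} (ha : Odd a) :
    p ∈ AddSubmonoid.closure {2, a} ↔ Even p ∨ a ≤ p := by
  simp only [AddSubmonoid.mem_closure_pair, smul_eq_mul]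
  constructor
  · rintro ⟨m, n, rfl⟩
    obtain rfl | hn := n.eq_zero_or_pos
    · exact Or.inl (by simp)
    · exact Or.inr (le_add_left (Nat.le_mul_of_pos_left a hn))
  · intro h
    obtain ⟨k, rfl⟩ | ⟨k, rfl⟩ := p.even_or_odd
    · exact ⟨k, 0, by lia⟩
    · obtain ⟨l, rfl⟩ := ha
      have hle := h.resolve_left (Nat.not_even_bit1 k)
      exact ⟨k - l, 1, by lia⟩

theorem mem_closure_three_four_iff {p : ℕ} :
    p ∈ AddSubmonoid.closure {3, 4} ↔ p ≠ 1 ∧ p ≠ 2 ∧ p ≠ 5 := by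
  simp only [AddSubmonoid.mem_closure_pair, smul_eq_mul]
  constructor
  · rintro ⟨m, n, rfl⟩
    lia
  · intro h
    exact ⟨(p - 4 * (p % 3)) / 3, p % 3, by lia⟩

theorem mem_closure_three_five_iff {p : ℕ} :
    p ∈ AddSubmonoid.closure {3, 5} ↔ p ≠ 1 ∧ p ≠ 2 ∧ p ≠ 4 ∧ p ≠ 7 := by
  simp only [AddSubmonoid.mem_closure_pair, smul_eq_mul]
  constructor
  · rintro ⟨m, n, rfl⟩
    lia
  · intro h
    exact ⟨(p - 5 * (2 * p % 3)) / 3, 2 * p % 3, by lia⟩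

theorem exists_subsingleton_diff_of_classification {H : AddSubmonoid ℕ}
    (hH : H = AddSubmonoid.closure {1} ∨
      (∃ a : ℕ, 2 < a ∧ Odd a ∧ H = AddSubmonoid.closure {2, a}) ∨
      H = AddSubmonoid.closure {3, 4} ∨ H = AddSubmonoid.closure {3, 5}) :
    ∃ c : ℕ, (∀ n, c ≤ n → n ∈ H) ∧
      ∀ m ∈ H, (((H : Set ℕ) ∩ Set.Ico m c) \ (m + ·) '' (H : Set ℕ)).Subsingleton := by
  suffices ∃ c : ℕ, (∀ n, c ≤ n → n ∈ H) ∧ ∀ m ∈ H, ∀ p ∈ H, ∀ q ∈ H, m ≤ p → p < c → m ≤ q →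
      q < c → p - m ∉ H → q - m ∉ H → p = q by
    obtain ⟨c, hc, h⟩ := this
    refine ⟨c, hc, fun m hm p ⟨⟨hp, hmp, hpc⟩, hpm⟩ q ⟨⟨hq, hmq, hqc⟩, hqm⟩ =>
      h m hm p hp q hq hmp hpc hmq hqc ?_ ?_⟩
    · exact fun h => hpm ⟨p - m, h, Nat.add_sub_of_le hmp⟩
    · exact fun h => hqm ⟨q - m, h, Nat.add_sub_of_le hmq⟩
  obtain rfl | ⟨a, -, ha, rfl⟩ | rfl | rfl := hH
  · exact ⟨0, fun n _ => AddSubmonoid.mem_closure_singleton.2 ⟨n, by simp⟩, by lia⟩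
  · simp only [mem_closure_two_iff ha]
    exact ⟨a - 1, by grind, by grind⟩
  · simp only [mem_closure_three_four_iff]
    exact ⟨6, by lia, by lia⟩
  · simp only [mem_closure_three_five_iff]
    exact ⟨8, by lia, by lia⟩

variable {H : AddSubmonoid ℕ}

theorem mem_of_three_mem {k n : ℕ} (h3 : 3 ∈ H) (hk : k ∈ H) (hk1 : k + 1 ∈ H) (hk2 : k + 2 ∈ H)
    (hn : k ≤ n) : n ∈ H := by
  have add_mul_mem (r : ℕ) (hr : r ∈ H) (q : ℕ) : r + q * 3 ∈ H :=
    H.add_mem hr (by simpa using H.nsmul_mem h3 q)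
  obtain ⟨q, rfl | rfl | rfl⟩ : ∃ q, n = k + q * 3 ∨ n = k + 1 + q * 3 ∨ n = k + 2 + q * 3 :=
    ⟨(n - k) / 3, by lia⟩
  exacts [add_mul_mem _ hk q, add_mul_mem _ hk1 q, add_mul_mem _ hk2 q]

theorem eq_closure_one (h1 : 1 ∈ H) : H = AddSubmonoid.closure {1} :=
  le_antisymm (fun n _ => AddSubmonoid.mem_closure_singleton.2 ⟨n, by simp⟩)
    (AddSubmonoid.closure_le.2 (Set.singleton_subset_iff.2 h1))

theorem exists_eq_closure_two (h1 : 1 ∉ H) (h2 : 2 ∈ H) (hodd : ∃ a ∈ H, Odd a) :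
    ∃ a : ℕ, 2 < a ∧ Odd a ∧ H = AddSubmonoid.closure {2, a} := by
  obtain ⟨a, ⟨haH, ha⟩, hmin⟩ :=
    exists_minimalFor_of_wellFoundedLT (fun a : ℕ => a ∈ H ∧ Odd a) id hodd
  have ha1 : a ≠ 1 := fun h => h1 (h ▸ haH)
  refine ⟨a, by grind, ha, le_antisymm (fun n hn => ?_)
    (AddSubmonoid.closure_le.2 (Set.pair_subset h2 haH))⟩
  rw [mem_closure_two_iff ha]
  exact n.even_or_odd.imp_right fun hn' => (le_total a n).elim id (hmin ⟨hn, hn'⟩)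

theorem eq_closure_three_four (h1 : 1 ∉ H) (h2 : 2 ∉ H) (h3 : 3 ∈ H) (h4 : 4 ∈ H) (h5 : 5 ∉ H) :
    H = AddSubmonoid.closure {3, 4} :=
  le_antisymm (fun _ hn => mem_closure_three_four_iff.2
      ⟨ne_of_mem_of_not_mem hn h1, ne_of_mem_of_not_mem hn h2, ne_of_mem_of_not_mem hn h5⟩)
    (AddSubmonoid.closure_le.2 (Set.pair_subset h3 h4))

theorem eq_closure_three_five (h1 : 1 ∉ H) (h2 : 2 ∉ H) (h3 : 3 ∈ H) (h4 : 4 ∉ H) (h5 : 5 ∈ H)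
    (h7 : 7 ∉ H) : H = AddSubmonoid.closure {3, 5} :=
  le_antisymm (fun _ hn => mem_closure_three_five_iff.2
      ⟨ne_of_mem_of_not_mem hn h1, ne_of_mem_of_not_mem hn h2, ne_of_mem_of_not_mem hn h4,
        ne_of_mem_of_not_mem hn h7⟩)
    (AddSubmonoid.closure_le.2 (Set.pair_subset h3 h5))

theorem classification_of_no_consecutive_gaps {c : ℕ} (hc : ∀ n, c ≤ n → n ∈ H)
    (hgap : ∀ p, 2 ≤ p → p ∉ H → p + 1 ∈ H)
    (hsym : ∀ g h, (∀ n, g + h + 1 ≤ n → n ∈ H) → g + h ∉ H → g ∉ H → h ∈ H) :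
    H = AddSubmonoid.closure {1} ∨
      (∃ a : ℕ, 2 < a ∧ Odd a ∧ H = AddSubmonoid.closure {2, a}) ∨
      H = AddSubmonoid.closure {3, 4} ∨ H = AddSubmonoid.closure {3, 5} := by
  by_cases h1 : 1 ∈ H
  · exact .inl (eq_closure_one h1)
  by_cases h2 : 2 ∈ H
  · exact .inr <| .inl <|
      exists_eq_closure_two h1 h2 ⟨2 * c + 1, hc _ (by lia), odd_two_mul_add_one c⟩
  have h3 : 3 ∈ H := hgap 2 le_rfl h2
  by_cases h4 : 4 ∈ H
  · have h5 : 5 ∉ H := fun h5 =>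
      h1 (hsym 1 1 (fun _ hn => mem_of_three_mem h3 h3 h4 h5 hn) h2 h1)
    exact .inr (.inr (.inl (eq_closure_three_four h1 h2 h3 h4 h5)))
  · have h5 : 5 ∈ H := hgap 4 (by lia) h4
    have h6 : 6 ∈ H := H.add_mem h3 h3
    have h7 : 7 ∉ H := fun h7 =>
      h2 (hsym 2 2 (fun _ hn => mem_of_three_mem h3 h5 h6 h7 hn) h4 h2)
    exact .inr (.inr (.inr (eq_closure_three_five h1 h2 h3 h4 h5 h7)))

end NumericalSemigroup

section IntegralClosure

variable {R : Type*} [CommRing R]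

theorem surjective_algebraMap_residueField [IsLocalRing R] {B : Type*} [CommRing B] [IsLocalRing B]
    [Algebra R B] [IsLocalHom (algebraMap R B)]
    (hres : Surjective (ResidueField.map (algebraMap R B))) :
    Surjective (algebraMap R (ResidueField B)) :=
  hres.comp residue_surjective

theorem dualIdeal_integralClosure_ne_bot [IsDomain R] {K : Type*} [Field K] [Algebra R K]
    [IsFractionRing R K] [Module.Finite R (integralClosure R K)] :
    dualIdeal (⊤ : Submodule R (integralClosure R K)) ≠ ⊥ := by
  obtain ⟨d, hd, h⟩ := FractionalIdeal.isFractional_of_fg (S := nonZeroDivisors R)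
    (I := Subalgebra.toSubmodule (integralClosure R K)) (Module.Finite.iff_fg.1 inferInstance)
  refine (Submodule.ne_bot_iff _).2 ⟨d, mem_dualIdeal.2 fun b _ => ?_, nonZeroDivisors.ne_zero hd⟩
  obtain ⟨r, hr⟩ := h b b.2
  exact Submodule.mem_one.2 ⟨r, Subtype.ext (hr.trans (Algebra.smul_def d (b : K)))⟩

end IntegralClosure

end TraceIdeals

theorem mainTheorem1 {R : Type*} [CommRing R] [IsDomain R] [IsNoetherianRing R] [IsLocalRing R]
    {K : Type*} [Field K] [Algebra R K] [IsFractionRing R K]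
    (hdim : ringKrullDim R = 1)
    [IsDiscreteValuationRing (integralClosure R K)]
    [Module.Finite R (integralClosure R K)]
    (hres : Function.Bijective
      (IsLocalRing.ResidueField.map (algebraMap R (integralClosure R K))))
    [Infinite (IsLocalRing.ResidueField R)]
    (hGor : TraceIdeals.IsGorensteinLocalRing R)
    (H : AddSubmonoid ℕ) (hH : H = TraceIdeals.valueSemigroup R (integralClosure R K)) :
    List.TFAE [
      {I : Ideal R | TraceIdeals.IsTraceIdeal I}.Finite,
      H = AddSubmonoid.closure {1} ∨
        (∃ a : ℕ, 2 < a ∧ Odd a ∧ H = AddSubmonoid.closure {2, a}) ∨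
        H = AddSubmonoid.closure {3, 4} ∨ H = AddSubmonoid.closure {3, 5},
      ∀ I : Ideal R, TraceIdeals.IsTraceIdeal I → TraceIdeals.IsIntegrallyClosedIdeal I] := by
  open TraceIdeals in
  subst hH
  have : Ring.KrullDimLE 1 R := Ring.krullDimLE_iff.2 hdim.le
  have : FaithfulSMul R (integralClosure R K) := .of_field_isFractionRing R _ K K
  have hres' := surjective_algebraMap_residueField hres.2
  have hcond := dualIdeal_integralClosure_ne_bot (R := R) (K := K)
  obtain ⟨C, hC⟩ := exists_maximalIdeal_pow_le_one hcond
  tfae_have 1 → 2 := fun hfin => by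
    refine classification_of_no_consecutive_gaps (fun n => mem_valueSemigroup_of_le hC)
      (fun p hp hpH => ?_) fun g h hc => ?_
    · by_contra hpH'
      exact infinite_isTraceIdeal hGor hcond hp hpH hpH' hfin
    · exact mem_valueSemigroup_of_isGorenstein hGor
        (maximalIdeal_pow_le_one_of_forall_mem hres' hC hc)
  tfae_have 2 → 3 := fun hcl I hI => by
    obtain ⟨c, hc, hcH⟩ := exists_subsingleton_diff_of_classification hcl
    exact hI.isIntegrallyClosedIdeal hres' (maximalIdeal_pow_le_one_of_forall_mem hres' hC hc) hcH
  tfae_have 3 → 1 := finite_isTraceIdeal_of_isIntegrallyClosedIdeal hC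
  tfae_finish
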